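/- Let $n\ge 0$, let $(M,\Omega)$ be a symplectic manifold of dimension $2n$ (smooth manifolds are Hausdorff and second countable, differential forms are real and smooth), and let $P\subset TM$ be a real polarization, i.e. an involutive smooth rank-$n$ distribution with $\Omega|_{P_x\times P_x}=0$ for every $x\in M$. A leaf of $P$ is a maximal connected integral submanifold of $P$. Let $N:=M/P$ be the space of leaves with the quotient topology, $\pi\colon M\to N$ the canonical projection, and assume that $N$ is a smooth $n$-dimensional quotient manifold, i.e. that it is equipped with a smooth structure for which $\pi$ is a smooth submersion. Let $K_P$ be the canonical bundle of $P$, with fibres $(K_P)_x=\bigwedge^n\mathrm{Ann}(P_x)$, where $\mathrm{Ann}(P_x)=\{\theta\in T_x^*M\mid \theta(u)=0\ \forall u\in P_x\}$. A section $\alpha\in\Gamma(M,K_P)$ is an $n$-form on $M$ with $\alpha_x\in (K_P)_x$ for all $x$; it is called $P$-polarized if $\iota_X(\mathrm{d}\alpha)=0$ for all $X\in\Gamma(M,P)$. Then: 1. for every $n$-form $\tilde\alpha$ on $N$, the pullback $\pi^*\tilde\alpha$ is a $P$-polarized section of $K_P$; 2. conversely, for every $P$-polarized section $\alpha$ of $K_P$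 there is an $n$-form $\tilde\alpha$ on $N$ with $\alpha=\pi^*\tilde\alpha$. -/

import Mathlib

open scoped Manifold ContDiff Topology

namespace GeomQuant

universe u

/-! ### Differential forms on an `m`-dimensional manifold -/

section Forms

variable {m : ℕ} {M : Type u} [TopologicalSpace M] [ChartedSpace (EuclideanSpace ℝ (Fin m)) M]

/-- The expression of a field of alternating `k`-linear forms in the preferred chart `φ` around
`x₀`, i.e. the pullback of `η` under `φ⁻¹`. It is meaningful on `φ.target`. -/
noncomputable def chartRep {k : ℕ} (η : ∀ x : M, TangentSpace (𝓡 m) x [⋀^Fin k]→L[ℝ] ℝ) (x₀ : M)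
    (y : EuclideanSpace ℝ (Fin m)) : EuclideanSpace ℝ (Fin m) [⋀^Fin k]→L[ℝ] ℝ :=
  (η ((extChartAt (𝓡 m) x₀).symm y)).compContinuousLinearMap
    (mfderiv 𝓘(ℝ, EuclideanSpace ℝ (Fin m)) (𝓡 m) (extChartAt (𝓡 m) x₀).symm y)

variable (m M) in
/-- Smooth differential `k`-forms on `M`: fields of alternating `k`-linear forms on the tangent
spaces whose coefficients in charts are smooth. -/
structure DiffForm (k : ℕ) where
  /-- The value of the form at a point. -/
  toFun : ∀ x : M, TangentSpace (𝓡 m) x [⋀^Fin k]→L[ℝ] ℝ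
  smooth : ∀ x₀ : M, ContDiffOn ℝ ∞ (chartRep toFun x₀) (extChartAt (𝓡 m) x₀).target

instance {k : ℕ} : CoeFun (DiffForm m M k)
    (fun _ => ∀ x : M, TangentSpace (𝓡 m) x [⋀^Fin k]→L[ℝ] ℝ) := ⟨DiffForm.toFun⟩

/-- The exterior derivative `dη`: at the point `x` it is computed in the preferred chart
around `x`. -/
noncomputable def DiffForm.d {k : ℕ} (η : DiffForm m M k) (x : M) :
    TangentSpace (𝓡 m) x [⋀^Fin (k + 1)]→L[ℝ] ℝ :=
  (extDeriv (chartRep η x) (extChartAt (𝓡 m) x x)).compContinuousLinearMap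
    (mfderiv (𝓡 m) 𝓘(ℝ, EuclideanSpace ℝ (Fin m)) (extChartAt (𝓡 m) x) x)

/-- The interior product `ι_v η` of an alternating form on `T_x M` with a tangent vector. -/
noncomputable def contract {k : ℕ} {x : M} (v : TangentSpace (𝓡 m) x)
    (η : TangentSpace (𝓡 m) x [⋀^Fin (k + 1)]→L[ℝ] ℝ) : TangentSpace (𝓡 m) x [⋀^Fin k]→L[ℝ] ℝ :=
  ContinuousAlternatingMap.curryLeft (E := EuclideanSpace ℝ (Fin m)) η v

theorem contract_apply {k : ℕ} {x : M} (v : TangentSpace (𝓡 m) x)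
    (η : TangentSpace (𝓡 m) x [⋀^Fin (k + 1)]→L[ℝ] ℝ) (w : Fin k → TangentSpace (𝓡 m) x) :
    contract v η w = η (Matrix.vecCons v w) := rfl

/-- The wedge product `θ₀ ∧ ⋯ ∧ θ_{k-1}` of covectors, with the normalization
`(θ₀ ∧ ⋯ ∧ θ_{k-1})(v₀, …, v_{k-1}) = det (θᵢ(vⱼ))`. -/
noncomputable def wedge {k : ℕ} {x : M} (θ : Fin k → (TangentSpace (𝓡 m) x →L[ℝ] ℝ)) :
    TangentSpace (𝓡 m) x [⋀^Fin k]→L[ℝ] ℝ :=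
  ContinuousMultilinearMap.alternatization
    ((ContinuousMultilinearMap.mkPiAlgebra ℝ (Fin k) ℝ).compContinuousLinearMap θ)

theorem wedge_apply {k : ℕ} {x : M} (θ : Fin k → (TangentSpace (𝓡 m) x →L[ℝ] ℝ))
    (v : Fin k → TangentSpace (𝓡 m) x) :
    wedge θ v = Matrix.det (Matrix.of fun i j => θ i (v j)) := by
  rw [← Matrix.det_transpose, Matrix.det_apply]
  simp [wedge, ContinuousMultilinearMap.alternatization_apply_apply]

end Forms

/-- The pullback `π^* β` of a form `β` on `N` under a map `π : M → N`, as a field of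
alternating forms on `M`. -/
noncomputable def pullback {m d k : ℕ} {M N : Type u}
    [TopologicalSpace M] [ChartedSpace (EuclideanSpace ℝ (Fin m)) M]
    [TopologicalSpace N] [ChartedSpace (EuclideanSpace ℝ (Fin d)) N]
    (π : M → N) (β : DiffForm d N k) (x : M) : TangentSpace (𝓡 m) x [⋀^Fin k]→L[ℝ] ℝ :=
  (β (π x)).compContinuousLinearMap (mfderiv (𝓡 m) (𝓡 d) π x)

/-! ### Distributions, leaves and the leaf space -/

section Distributions

variable {m : ℕ} {M : Type u} [TopologicalSpace M] [ChartedSpace (EuclideanSpace ℝ (Fin m)) M]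

/-- `X` is a smooth vector field on the set `U`. -/
def IsSmoothVectorFieldOn [IsManifold (𝓡 m) ∞ M] (X : ∀ x : M, TangentSpace (𝓡 m) x)
    (U : Set M) : Prop :=
  ContMDiffOn (𝓡 m) (𝓡 m).tangent ∞ (fun x => (⟨x, X x⟩ : TangentBundle (𝓡 m) M)) U

/-- `D` is a (real, smooth) distribution of rank `k`: a smooth rank-`k` subbundle of `TM`. -/
def IsDistribution [IsManifold (𝓡 m) ∞ M] (k : ℕ)
    (D : ∀ x : M, Submodule ℝ (TangentSpace (𝓡 m) x)) : Prop :=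
  (∀ x, Module.finrank ℝ (D x) = k) ∧
  ∀ x₀ : M, ∃ U : Set M, IsOpen U ∧ x₀ ∈ U ∧
    ∃ X : Fin k → ∀ x : M, TangentSpace (𝓡 m) x,
      (∀ i, IsSmoothVectorFieldOn (X i) U) ∧
      ∀ x ∈ U, D x = Submodule.span ℝ (Set.range fun i => X i x)

/-- `X ∈ Γ(M, D)`: `X` is a smooth (global) section of `D`. -/
def IsSection [IsManifold (𝓡 m) ∞ M] (D : ∀ x : M, Submodule ℝ (TangentSpace (𝓡 m) x))
    (X : ∀ x : M, TangentSpace (𝓡 m) x) : Prop :=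
  IsSmoothVectorFieldOn X Set.univ ∧ ∀ x, X x ∈ D x

/-- `D` is involutive: `X, Y ∈ Γ(M, D)` implies `[X, Y] ∈ Γ(M, D)`. -/
def IsInvolutive [IsManifold (𝓡 m) ∞ M]
    (D : ∀ x : M, Submodule ℝ (TangentSpace (𝓡 m) x)) : Prop :=
  ∀ X Y : ∀ x : M, TangentSpace (𝓡 m) x, IsSection D X → IsSection D Y →
    IsSection D (VectorField.mlieBracket (𝓡 m) X Y)

/-- `i : S → M` is a connected integral submanifold of the rank-`k` distribution `D`: an
injectively immersed connected `k`-dimensional manifold with `T_s S = D_{i(s)}`. -/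
structure IsIntegralSubmanifold (k : ℕ) (D : ∀ x : M, Submodule ℝ (TangentSpace (𝓡 m) x))
    (S : Type u) [TopologicalSpace S] [ChartedSpace (EuclideanSpace ℝ (Fin k)) S]
    (i : S → M) : Prop where
  isManifold : IsManifold (𝓡 k) ∞ S
  t2 : T2Space S
  secondCountable : SecondCountableTopology S
  connected : ConnectedSpace S
  injective : Function.Injective i
  smooth : ContMDiff (𝓡 k) (𝓡 m) ∞ i
  range_mfderiv : ∀ s, LinearMap.range (mfderiv (𝓡 k) (𝓡 m) i s).toLinearMap = D (i s)

/-- The points `x` and `y` lie on a common connected integral submanifold of `D`. -/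
def OnCommonIntegralSubmanifold (k : ℕ) (D : ∀ x : M, Submodule ℝ (TangentSpace (𝓡 m) x))
    (x y : M) : Prop :=
  ∃ (S : Type u) (_ : TopologicalSpace S) (_ : ChartedSpace (EuclideanSpace ℝ (Fin k)) S)
    (i : S → M), IsIntegralSubmanifold k D S i ∧ x ∈ Set.range i ∧ y ∈ Set.range i

/-- The relation "`x` and `y` lie on the same leaf". For an involutive distribution the relation
`OnCommonIntegralSubmanifold` already is an equivalence relation, whose classes are the leaves
(maximal connected integral submanifolds) of `D`, so passing to the generated equivalence relation
changes nothing; it makes the definition independent of that theorem. -/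
def leafSetoid (k : ℕ) (D : ∀ x : M, Submodule ℝ (TangentSpace (𝓡 m) x)) : Setoid M :=
  Relation.EqvGen.setoid (OnCommonIntegralSubmanifold k D)

/-- The space of leaves `M / D`. -/
def LeafSpace (k : ℕ) (D : ∀ x : M, Submodule ℝ (TangentSpace (𝓡 m) x)) : Type u :=
  Quotient (leafSetoid k D)

/-- The leaf space carries the quotient topology. -/
instance (k : ℕ) (D : ∀ x : M, Submodule ℝ (TangentSpace (𝓡 m) x)) :
    TopologicalSpace (LeafSpace k D) :=
  inferInstanceAs (TopologicalSpace (Quotient (leafSetoid k D)))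

/-- The canonical projection `M → M / D`. -/
def leafProj (k : ℕ) (D : ∀ x : M, Submodule ℝ (TangentSpace (𝓡 m) x)) : M → LeafSpace k D :=
  Quotient.mk (leafSetoid k D)

end Distributions

/-! ### Symplectic manifolds, real polarizations and the canonical bundle -/

section Polarizations

variable {m : ℕ} {M : Type u} [TopologicalSpace M] [ChartedSpace (EuclideanSpace ℝ (Fin m)) M]

/-- `Ω` is a symplectic form: a closed nondegenerate `2`-form. -/
structure IsSymplectic (Ω : DiffForm m M 2) : Prop where
  closed : ∀ x, Ω.d x = 0
  nondegenerate : ∀ (x : M) (v : TangentSpace (𝓡 m) x),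
    (∀ w : TangentSpace (𝓡 m) x, Ω x ![v, w] = 0) → v = 0

/-- `P` is a real polarization of the `2n`-dimensional symplectic manifold `(M, Ω)`: an
involutive distribution by Lagrangian subspaces. -/
structure IsRealPolarization {n : ℕ} {M : Type u} [TopologicalSpace M]
    [ChartedSpace (EuclideanSpace ℝ (Fin (2 * n))) M] [IsManifold (𝓡 (2 * n)) ∞ M]
    (Ω : DiffForm (2 * n) M 2) (P : ∀ x : M, Submodule ℝ (TangentSpace (𝓡 (2 * n)) x)) :
    Prop where
  distribution : IsDistribution n P
  involutive : IsInvolutive P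
  isotropic : ∀ x, ∀ v ∈ P x, ∀ w ∈ P x, Ω x ![v, w] = 0

/-- The fibre `⋀ⁿ Ann(P_x)` of the canonical bundle `K_P`, as a subspace of `⋀ⁿ T_x^* M`. -/
noncomputable def canonicalFiber (n : ℕ) (P : ∀ x : M, Submodule ℝ (TangentSpace (𝓡 m) x))
    (x : M) : Submodule ℝ (TangentSpace (𝓡 m) x [⋀^Fin n]→L[ℝ] ℝ) :=
  Submodule.span ℝ
    {η | ∃ θ : Fin n → (TangentSpace (𝓡 m) x →L[ℝ] ℝ),
      (∀ i, ∀ u ∈ P x, θ i u = 0) ∧ η = wedge θ}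

/-- `α` is a (smooth) section of the canonical bundle `K_P`. -/
def IsCanonicalSection {n : ℕ} (P : ∀ x : M, Submodule ℝ (TangentSpace (𝓡 m) x))
    (α : DiffForm m M n) : Prop :=
  ∀ x, α x ∈ canonicalFiber n P x

/-- `α` is a `P`-polarized section of `K_P`: a section with `ι_X (dα) = 0` for all
`X ∈ Γ(M, P)`. -/
def IsPolarizedSection [IsManifold (𝓡 m) ∞ M] {n : ℕ}
    (P : ∀ x : M, Submodule ℝ (TangentSpace (𝓡 m) x)) (α : DiffForm m M n) : Prop :=
  IsCanonicalSection P α ∧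
    ∀ X : ∀ x : M, TangentSpace (𝓡 m) x, IsSection P X → ∀ x, contract (X x) (α.d x) = 0

end Polarizations

end GeomQuant

open GeomQuant

/-! Everything rests on the equality of `P` with the kernel of `dπ` (`ker_mfderiv_leafProj`). Since
`π` is constant on integral submanifolds, `dπ` kills their tangent spaces; for `n > 0` the fibres of
the submersion are not singletons, so the relation generating the leaves must place an integral
submanifold through each point. Equality follows from `n + n = 2n`.

Pullbacks are then polarized: a top-degree form on an `n`-dimensional space is a multiple of a
determinant of coordinates, whose pullbacks annihilate `P`, and `d` commutes with pullback.

Conversely, `α` at `x` annihilates `ker dπ`, so it is the pullback of a form `B x` on the tangent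
space of `N` at `π x`. In submersion coordinates, for a constant vertical `w`, Cartan's formula `L_w
= ι_w d + d ι_w` shows that the coefficients of `α` do not vary along `w`. Hence `B` is locally
constant along fibres (`eventually_eq_of_contract`), and connectedness of integral submanifolds
makes it constant on leaves (`eq_of_leafProj_eq`). The descended form is smooth because locally it
is the pullback of `α` under a smooth section of `π` (`exists_eq_pullback`). -/

namespace GeomQuant

universe u

/-! ### Alternating maps on normed spaces -/

section AlternatingMaps

variable {E F G : Type*} [NormedAddCommGroup E] [NormedSpace ℝ E] [NormedAddCommGroup F]
  [NormedSpace ℝ F] [NormedAddCommGroup G] [NormedSpace ℝ G] {k : ℕ}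

/-- Alternatization of continuous multilinear maps as a continuous linear map. -/
noncomputable def alternatizationCLM :
    ContinuousMultilinearMap ℝ (fun _ : Fin k => E) F →L[ℝ] E [⋀^Fin k]→L[ℝ] F :=
  LinearMap.mkContinuous
    { toFun := ContinuousMultilinearMap.alternatization
      map_add' := map_add _
      map_smul' := fun c f => by
        ext v
        simp [ContinuousMultilinearMap.alternatization_apply_apply, Finset.smul_sum,
          smul_comm c] }
    (Fintype.card (Equiv.Perm (Fin k))) fun f => by
      refine ContinuousAlternatingMap.opNorm_le_bound _ (by positivity) fun v => ?_
      simp only [LinearMap.coe_mk, AddHom.coe_mk,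
        ContinuousMultilinearMap.alternatization_apply_apply]
      calc _ ≤ ∑ _σ : Equiv.Perm (Fin k), ‖f‖ * ∏ i, ‖v i‖ := by
            refine norm_sum_le_of_le _ fun σ _ => ?_
            have h1 : ‖Equiv.Perm.sign σ • f (v ∘ σ)‖ = ‖f (v ∘ σ)‖ := by
              rcases Int.units_eq_one_or (Equiv.Perm.sign σ) with h | h <;> simp [h]
            refine h1.trans_le ?_
            rw [← Equiv.prod_comp σ fun i => ‖v i‖]
            exact f.le_opNorm _
        _ = _ := by simp [mul_assoc]

theorem alternatizationCLM_toContinuousMultilinearMap (f : E [⋀^Fin k]→L[ℝ] F) :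
    alternatizationCLM f.toContinuousMultilinearMap = (k.factorial : ℝ) • f := by
  ext v
  have h := congrArg (fun g => g v) (AlternatingMap.coe_alternatization f.toAlternatingMap)
  simp only [MultilinearMap.alternatization_apply, Fintype.card_fin] at h
  simp only [alternatizationCLM, LinearMap.mkContinuous_apply, LinearMap.coe_mk, AddHom.coe_mk,
    ContinuousMultilinearMap.alternatization_apply_apply, ContinuousAlternatingMap.smul_apply,
    Nat.cast_smul_eq_nsmul]
  exact h

/-- The expression is linear in the form and polynomial in the linear map. This is visible for
multilinear maps; alternatization, divided by `k!`, carries it back to alternating ones. -/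
theorem contDiff_compContinuousLinearMap {n : WithTop ℕ∞} :
    ContDiff ℝ n fun p : (F [⋀^Fin k]→L[ℝ] G) × (E →L[ℝ] F) =>
      p.1.compContinuousLinearMap p.2 := by
  have h1 : ContDiff ℝ n fun p : (F [⋀^Fin k]→L[ℝ] G) × (E →L[ℝ] F) =>
      p.1.toContinuousMultilinearMap.compContinuousLinearMap fun _ => p.2 := by
    have h2 : ContDiff ℝ n fun p : (F [⋀^Fin k]→L[ℝ] G) × (E →L[ℝ] F) =>
        ContinuousMultilinearMap.compContinuousLinearMapContinuousMultilinear ℝ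
          (fun _ : Fin k => E) (fun _ : Fin k => F) G (fun _ => p.2) :=
      (ContinuousMultilinearMap.contDiff _).comp (contDiff_pi.2 fun _ => contDiff_snd)
    have h3 : ContDiff ℝ n fun f : F [⋀^Fin k]→L[ℝ] G => f.toContinuousMultilinearMap :=
      (ContinuousAlternatingMap.toContinuousMultilinearMapCLM ℝ :
        F [⋀^Fin k]→L[ℝ] G →L[ℝ] _).contDiff
    exact h2.clm_apply (h3.comp contDiff_fst)
  have h3 := (alternatizationCLM.contDiff.comp h1).const_smul ((k.factorial : ℝ)⁻¹)
  convert h3 using 2 with p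
  have h4 := alternatizationCLM_toContinuousMultilinearMap (p.1.compContinuousLinearMap p.2)
  have h5 : (k.factorial : ℝ) ≠ 0 := by positivity
  calc _ = (k.factorial : ℝ)⁻¹ • (k.factorial : ℝ) • p.1.compContinuousLinearMap p.2 := by
        rw [inv_smul_smul₀ h5]
    _ = _ := by rw [← h4]; rfl

/-- An alternating map killing `K` depends on its arguments modulo `K` only. -/
theorem apply_eq_of_sub_mem (f : E [⋀^Fin k]→L[ℝ] G) (K : Submodule ℝ E)
    (hf : ∀ v : Fin k → E, (∃ i, v i ∈ K) → f v = 0) {v w : Fin k → E}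
    (h : ∀ i, v i - w i ∈ K) : f v = f w := by
  have h1 : v = w + (v - w) := by abel
  rw [h1]
  have h2 := f.toMultilinearMap.map_add_univ w (v - w)
  refine h2.trans ?_
  rw [Finset.sum_eq_single Finset.univ]
  · simp
  · intro s _ hs
    obtain ⟨i, hi⟩ : ∃ i, i ∉ s := by
      by_contra! h3
      exact hs (Finset.eq_univ_iff_forall.2 h3)
    exact hf _ ⟨i, by simpa [hi] using h i⟩
  · simp

/-- The form `g` is `f ∘ R`: the vectors `v` and `R (L v)` differ by an element of `ker L`, which
`f` ignores. -/
theorem exists_eq_compContinuousLinearMap {L : E →L[ℝ] F} {R : F →L[ℝ] E}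
    (hLR : ∀ z, L (R z) = z) (f : E [⋀^Fin k]→L[ℝ] G)
    (hf : ∀ v : Fin k → E, (∃ i, L (v i) = 0) → f v = 0) :
    ∃ g : F [⋀^Fin k]→L[ℝ] G, f = g.compContinuousLinearMap L := by
  refine ⟨f.compContinuousLinearMap R, ?_⟩
  ext v
  refine apply_eq_of_sub_mem f (LinearMap.ker L.toLinearMap) (fun w hw => hf w ?_) fun i => ?_
  · simpa using hw
  · simp [hLR]

/-- If a form and its exterior derivative are killed by `w` near a point, the derivative of the
form in the direction `w` vanishes there. -/
theorem fderiv_apply_eq_zero_of_contract {η : E → E [⋀^Fin k]→L[ℝ] G} {x : E}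
    (hd : DifferentiableAt ℝ η x) {w : E}
    (h0 : ∀ᶠ y in 𝓝 x, ∀ v : Fin k → E, (∃ i, v i = w) → η y v = 0)
    (h1 : ∀ v : Fin k → E, extDeriv η x (Matrix.vecCons w v) = 0) : fderiv ℝ η x w = 0 := by
  ext v
  have h2 := h1 v
  -- Term `0` of the sum is the derivative along `w`. Every other term differentiates `η` with `w`
  -- still among its arguments, a function vanishing near `x`.
  rw [extDeriv_apply hd, Fin.sum_univ_succ, Finset.sum_eq_zero, add_zero] at h2
  · have h3 : fderiv ℝ (fun y => η y v) x w = 0 := by simpa using h2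
    have h4 := ((ContinuousAlternatingMap.apply ℝ E G v).hasFDerivAt.comp x
      hd.hasFDerivAt).fderiv
    have h5 : (ContinuousAlternatingMap.apply ℝ E G v ∘ η) = fun y => η y v := rfl
    rw [h5] at h4
    rw [h4] at h3
    simpa using h3
  · intro i _
    have h3 : (fun y => η y (i.succ.removeNth (Matrix.vecCons w v))) =ᶠ[𝓝 x] fun _ => 0 := by
      filter_upwards [h0] with y hy
      refine hy _ ?_
      obtain ⟨k, rfl⟩ : ∃ l, k = l + 1 := ⟨k - 1, by have := i.2; omega⟩
      exact ⟨0, by simp [Fin.removeNth]⟩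
    rw [h3.fderiv_eq]
    simp

end AlternatingMaps

/-! ### Local expressions of forms along parametrizations -/

section Representatives

variable {m k : ℕ} {M : Type u} [TopologicalSpace M] [ChartedSpace (EuclideanSpace ℝ (Fin m)) M]
  {E : Type*} [NormedAddCommGroup E] [NormedSpace ℝ E]

/-- The pullback of a field of alternating forms on `M` under a map `g : E → M` from a vector
space. -/
noncomputable def rep (α : ∀ x : M, TangentSpace (𝓡 m) x [⋀^Fin k]→L[ℝ] ℝ) (g : E → M) (y : E) :
    E [⋀^Fin k]→L[ℝ] ℝ :=
  (α (g y)).compContinuousLinearMap (mfderiv 𝓘(ℝ, E) (𝓡 m) g y)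

theorem rep_apply (α : ∀ x : M, TangentSpace (𝓡 m) x [⋀^Fin k]→L[ℝ] ℝ) (g : E → M) (y : E)
    (v : Fin k → E) : rep α g y v = α (g y) fun i => mfderiv 𝓘(ℝ, E) (𝓡 m) g y (v i) := rfl

theorem chartRep_eq_rep (α : ∀ x : M, TangentSpace (𝓡 m) x [⋀^Fin k]→L[ℝ] ℝ) (x₀ : M) :
    chartRep α x₀ = rep α (extChartAt (𝓡 m) x₀).symm := rfl

theorem rep_congr (α : ∀ x : M, TangentSpace (𝓡 m) x [⋀^Fin k]→L[ℝ] ℝ) {g h : E → M} {y : E}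
    (hgh : g =ᶠ[𝓝 y] h) : rep α g y = rep α h y := by
  ext v
  rw [rep_apply, rep_apply, hgh.mfderiv_eq, hgh.eq_of_nhds]

theorem rep_comp (α : ∀ x : M, TangentSpace (𝓡 m) x [⋀^Fin k]→L[ℝ] ℝ) {F : Type*}
    [NormedAddCommGroup F] [NormedSpace ℝ F] {g : F → M} {h : E → F} {y : E}
    (hg : MDifferentiableAt 𝓘(ℝ, F) (𝓡 m) g (h y)) (hh : DifferentiableAt ℝ h y) :
    rep α (g ∘ h) y = (rep α g (h y)).compContinuousLinearMap (fderiv ℝ h y) := by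
  ext v
  rw [rep_apply, mfderiv_comp y hg hh.mdifferentiableAt, mfderiv_eq_fderiv]
  rfl

theorem DiffForm.contDiffAt_chartRep (α : DiffForm m M k) (x : M) :
    ContDiffAt ℝ ∞ (chartRep α x) (extChartAt (𝓡 m) x x) :=
  (α.smooth x).contDiffAt ((isOpen_extChartAt_target x).mem_nhds (mem_extChartAt_target x))

variable [IsManifold (𝓡 m) ∞ M]

/-- Near `y`, the pullback of `α` under `g` is the pullback of the chart expression of `α` under
the chart expression of `g`. -/
theorem rep_eventuallyEq (α : ∀ x : M, TangentSpace (𝓡 m) x [⋀^Fin k]→L[ℝ] ℝ) {g : E → M}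
    {V : Set E} (hV : IsOpen V) (hg : ContMDiffOn 𝓘(ℝ, E) (𝓡 m) ∞ g V) {y : E} (hy : y ∈ V) :
    ∃ W, IsOpen W ∧ y ∈ W ∧ W ⊆ V ∧ Set.MapsTo g W (extChartAt (𝓡 m) (g y)).source ∧
      ContDiffOn ℝ ∞ (extChartAt (𝓡 m) (g y) ∘ g) W ∧
      ∀ z ∈ W, rep α g z = (chartRep α (g y) (extChartAt (𝓡 m) (g y) (g z))).compContinuousLinearMap
        (fderiv ℝ (extChartAt (𝓡 m) (g y) ∘ g) z) := by
  set φ := extChartAt (𝓡 m) (g y) with hφ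
  have hW : IsOpen (V ∩ g ⁻¹' φ.source) :=
    hg.continuousOn.isOpen_inter_preimage hV (isOpen_extChartAt_source _)
  have hsm : ContDiffOn ℝ ∞ (φ ∘ g) (V ∩ g ⁻¹' φ.source) := by
    rw [← contMDiffOn_iff_contDiffOn]
    refine ContMDiffOn.comp (t := φ.source) ?_ (hg.mono Set.inter_subset_left)
      fun z hz => hz.2
    rw [hφ, extChartAt_source]
    exact contMDiffOn_extChartAt
  refine ⟨V ∩ g ⁻¹' φ.source, hW, ⟨hy, mem_extChartAt_source _⟩, Set.inter_subset_left,
    fun z hz => hz.2, hsm, fun z hz => ?_⟩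
  have h1 : g =ᶠ[𝓝 z] φ.symm ∘ (φ ∘ g) := by
    filter_upwards [hW.mem_nhds hz] with w hw
    exact (φ.left_inv hw.2).symm
  rw [rep_congr α h1, rep_comp]
  · rfl
  · have := (contMDiffOn_extChartAt_symm (I := 𝓡 m) (n := ∞) (g y)).contMDiffAt
      ((isOpen_extChartAt_target (g y)).mem_nhds (φ.map_source hz.2))
    exact this.mdifferentiableAt (by simp)
  · exact (hsm.contDiffAt (hW.mem_nhds hz)).differentiableAt (by simp)

theorem DiffForm.contDiffOn_rep (α : DiffForm m M k) {g : E → M} {V : Set E} (hV : IsOpen V)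
    (hg : ContMDiffOn 𝓘(ℝ, E) (𝓡 m) ∞ g V) : ContDiffOn ℝ ∞ (rep α g) V := by
  intro y hy
  obtain ⟨W, hW, hyW, -, hmaps, hsm, h⟩ := rep_eventuallyEq α hV hg hy
  refine ContDiffAt.contDiffWithinAt ?_
  have h1 : ContDiffOn ℝ ∞ (fun z => (chartRep α (g y)
      (extChartAt (𝓡 m) (g y) (g z))).compContinuousLinearMap
        (fderiv ℝ (extChartAt (𝓡 m) (g y) ∘ g) z)) W := by
    refine contDiff_compContinuousLinearMap.comp_contDiffOn (ContDiffOn.prodMk ?_ ?_)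
    · exact (α.smooth (g y)).comp hsm fun z hz => (extChartAt (𝓡 m) (g y)).map_source (hmaps hz)
    · exact hsm.fderiv_of_isOpen hW (by simp)
  exact (h1.contDiffAt (hW.mem_nhds hyW)).congr_of_eventuallyEq
    (Filter.eventually_of_mem (hW.mem_nhds hyW) h)

/-- Naturality of `d` on vector spaces, applied to `g` read in the chart around `g y`, the very
chart in which `α.d (g y)` is computed. It frees `d` from the preferred charts. -/
theorem DiffForm.extDeriv_rep (α : DiffForm m M k) {g : E → M} {V : Set E} (hV : IsOpen V)
    (hg : ContMDiffOn 𝓘(ℝ, E) (𝓡 m) ∞ g V) {y : E} (hy : y ∈ V) :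
    extDeriv (rep α g) y =
      (α.d (g y)).compContinuousLinearMap (mfderiv 𝓘(ℝ, E) (𝓡 m) g y) := by
  obtain ⟨W, hW, hyW, -, hmaps, hsm, h⟩ := rep_eventuallyEq α hV hg hy
  have h1 : rep α g =ᶠ[𝓝 y] _ := Filter.eventually_of_mem (hW.mem_nhds hyW) h
  rw [h1.extDeriv_eq]
  refine (extDeriv_pullback (r := ∞) (f := extChartAt (𝓡 m) (g y) ∘ g)
    ((α.contDiffAt_chartRep (g y)).differentiableAt (by simp))
    (hsm.contDiffAt (hW.mem_nhds hyW)) 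
      (by simpa using WithTop.coe_le_coe.2 (le_top : (2 : ℕ∞) ≤ ⊤))).trans ?_
  have h2 : fderiv ℝ (extChartAt (𝓡 m) (g y) ∘ g) y =
      (mfderiv (𝓡 m) 𝓘(ℝ, EuclideanSpace ℝ (Fin m)) (extChartAt (𝓡 m) (g y)) (g y)).comp
        (mfderiv 𝓘(ℝ, E) (𝓡 m) g y) := by
    rw [← mfderiv_eq_fderiv]
    refine mfderiv_comp y ?_ ?_
    · exact mdifferentiableAt_extChartAt (mem_chart_source _ _)
    · exact (hg.contMDiffAt (hV.mem_nhds hy)).mdifferentiableAt (by simp)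
  rw [h2]
  rfl

end Representatives

/-! ### Normal form, local sections and kernels of submersions -/

section Submersions

variable {m n : ℕ} {M N : Type u} [TopologicalSpace M] [ChartedSpace (EuclideanSpace ℝ (Fin m)) M]
  [TopologicalSpace N] [ChartedSpace (EuclideanSpace ℝ (Fin n)) N]

variable (m n) in
/-- A local normal form of a submersion `f` at `x`: parametrizations `g` of `M` near `x` and `h`
of `N` near `f x`, with inverses `φ` and `ψ`, for which `f ∘ g = h ∘ L` with `L` a linear map that
has the right inverse `R`. -/
structure SubmersionChart (f : M → N) (x : M) where
  V : Set (EuclideanSpace ℝ (Fin m))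
  W : Set N
  g : EuclideanSpace ℝ (Fin m) → M
  φ : M → EuclideanSpace ℝ (Fin m)
  h : EuclideanSpace ℝ (Fin n) → N
  ψ : N → EuclideanSpace ℝ (Fin n)
  L : EuclideanSpace ℝ (Fin m) →L[ℝ] EuclideanSpace ℝ (Fin n)
  R : EuclideanSpace ℝ (Fin n) →L[ℝ] EuclideanSpace ℝ (Fin m)
  isOpen_V : IsOpen V
  isOpen_W : IsOpen W
  φ_mem : φ x ∈ V
  mem_W : f x ∈ W
  g_φ : g (φ x) = x
  eventually_g_φ : ∀ᶠ z in 𝓝 x, g (φ z) = z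
  φ_g : ∀ y ∈ V, φ (g y) = y
  continuousAt_φ : ContinuousAt φ x
  contMDiffOn_g : ContMDiffOn 𝓘(ℝ, EuclideanSpace ℝ (Fin m)) (𝓡 m) ∞ g V
  contMDiffAt_h : ∀ y ∈ V, ContMDiffAt 𝓘(ℝ, EuclideanSpace ℝ (Fin n)) (𝓡 n) ∞ h (L y)
  contMDiffOn_ψ : ContMDiffOn (𝓡 n) 𝓘(ℝ, EuclideanSpace ℝ (Fin n)) ∞ ψ W
  h_ψ : ∀ q ∈ W, h (ψ q) = q
  f_mem : ∀ y ∈ V, f (g y) ∈ W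
  ψ_f : ∀ y ∈ V, ψ (f (g y)) = L y
  L_R : ∀ z, L (R z) = z

/-- In suitable charts a submersion is the first projection of a product; `L` is that projection and
`R` the inclusion of the first factor. -/
theorem nonempty_submersionChart {f : M → N} (hf : Manifold.IsSubmersion (𝓡 m) (𝓡 n) ∞ f)
    (x : M) : Nonempty (SubmersionChart m n f x) := by
  obtain ⟨F, _, _, hF⟩ := hf
  have hx := hF x
  have hd : x ∈ (hx.domChart.extend (𝓡 m)).source := by
    rw [OpenPartialHomeomorph.extend_source]
    exact hx.mem_domChart_source
  have hmaps : ∀ y ∈ (hx.domChart.extend (𝓡 m)).target,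
      f ((hx.domChart.extend (𝓡 m)).symm y) ∈ hx.codChart.source := fun y hy =>
    hx.mapsto_domChart_source_codChart_source (by
      have := (hx.domChart.extend (𝓡 m)).map_target hy
      rwa [OpenPartialHomeomorph.extend_source] at this)
  exact ⟨{
    V := (hx.domChart.extend (𝓡 m)).target
    W := hx.codChart.source
    g := (hx.domChart.extend (𝓡 m)).symm
    φ := hx.domChart.extend (𝓡 m)
    h := (hx.codChart.extend (𝓡 n)).symm
    ψ := hx.codChart.extend (𝓡 n)
    L := (ContinuousLinearMap.fst ℝ _ _).comp hx.equiv.toContinuousLinearMap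
    R := hx.equiv.symm.toContinuousLinearMap.comp (ContinuousLinearMap.inl ℝ _ _)
    isOpen_V := hx.domChart.isOpen_extend_target
    isOpen_W := hx.codChart.open_source
    φ_mem := (hx.domChart.extend (𝓡 m)).map_source hd
    mem_W := hx.mem_codChart_source
    g_φ := (hx.domChart.extend (𝓡 m)).left_inv hd
    eventually_g_φ := by
      filter_upwards [hx.domChart.open_source.mem_nhds hx.mem_domChart_source] with z hz
      exact (hx.domChart.extend (𝓡 m)).left_inv
        (by rwa [OpenPartialHomeomorph.extend_source])
    φ_g := fun y hy => (hx.domChart.extend (𝓡 m)).right_inv hy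
    continuousAt_φ := hx.domChart.continuousAt_extend hx.mem_domChart_source
    contMDiffOn_g := by
      rw [OpenPartialHomeomorph.extend_target_eq_image_source,
        OpenPartialHomeomorph.extend_coe, Set.image_comp,
        OpenPartialHomeomorph.image_source_eq_target]
      exact contMDiffOn_extend_symm hx.domChart_mem_maximalAtlas
    contMDiffAt_h := fun y hy => by
      have h1 := contMDiffOn_extend_symm (I := 𝓡 n) hx.codChart_mem_maximalAtlas
      rw [← OpenPartialHomeomorph.image_source_eq_target, ← Set.image_comp,
        ← OpenPartialHomeomorph.extend_coe,
        ← OpenPartialHomeomorph.extend_target_eq_image_source] at h1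
      exact h1.contMDiffAt (hx.codChart.isOpen_extend_target.mem_nhds
        (hx.target_subset_preimage_target hy))
    contMDiffOn_ψ :=
      OpenPartialHomeomorph.contMDiffOn_extend hx.codChart_mem_maximalAtlas
    h_ψ := fun q hq => (hx.codChart.extend (𝓡 n)).left_inv
      (by rwa [OpenPartialHomeomorph.extend_source])
    f_mem := hmaps
    ψ_f := fun y hy => hx.writtenInCharts hy
    L_R := fun z => by simp }⟩

namespace SubmersionChart

variable {f : M → N} {x : M}

theorem f_g (c : SubmersionChart m n f x) {y : EuclideanSpace ℝ (Fin m)} (hy : y ∈ c.V) : f (c.g y) = c.h (c.L y) := by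
  rw [← c.ψ_f y hy, c.h_ψ _ (c.f_mem y hy)]

theorem ψ_f_self (c : SubmersionChart m n f x) : c.ψ (f x) = c.L (c.φ x) := by
  simpa [c.g_φ] using c.ψ_f _ c.φ_mem

theorem surjective_mfderiv_h (c : SubmersionChart m n f x) :
    Function.Surjective (mfderiv 𝓘(ℝ, EuclideanSpace ℝ (Fin n)) (𝓡 n) c.h (c.L (c.φ x))) := by
  have h1 : c.h ∘ c.ψ =ᶠ[𝓝 (f x)] id :=
    Filter.eventually_of_mem (c.isOpen_W.mem_nhds c.mem_W) c.h_ψ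
  have h2 := mfderiv_comp (f x) (I := 𝓡 n) (I' := 𝓘(ℝ, EuclideanSpace ℝ (Fin n)))
    (I'' := 𝓡 n) (g := c.h) (f := c.ψ)
    (by rw [ψ_f_self]; exact (c.contMDiffAt_h _ c.φ_mem).mdifferentiableAt (by simp))
    ((c.contMDiffOn_ψ.contMDiffAt (c.isOpen_W.mem_nhds c.mem_W)).mdifferentiableAt (by simp))
  rw [h1.mfderiv_eq, mfderiv_id] at h2
  intro v
  have h3 := congrArg (fun A => A v) h2
  rw [← c.ψ_f_self]
  exact ⟨_, h3.symm⟩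

/-- A submersion has smooth local sections through every point. -/
theorem exists_localSection (c : SubmersionChart m n f x) :
    ∃ (σ : N → M) (Q : Set N), IsOpen Q ∧ f x ∈ Q ∧ σ (f x) = x ∧
    ContMDiffOn (𝓡 n) (𝓡 m) ∞ σ Q ∧ ∀ q ∈ Q, f (σ q) = q := by
  -- The affine lift normalized to pass through `φ x` over `f x`; `L ∘ R = id` gives `L (τ q) = ψ
  -- q`.
  set τ : N → EuclideanSpace ℝ (Fin m) := fun q => c.φ x + c.R (c.ψ q - c.L (c.φ x)) with hτ
  have h1 : ContMDiffOn (𝓡 n) 𝓘(ℝ, EuclideanSpace ℝ (Fin m)) ∞ τ c.W := by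
    have h2 : ContDiff ℝ ∞ fun z : EuclideanSpace ℝ (Fin n) =>
      c.φ x + c.R (z - c.L (c.φ x)) := by fun_prop
    exact h2.contMDiff.comp_contMDiffOn c.contMDiffOn_ψ
  have h2 : τ (f x) = c.φ x := by simp [hτ, c.ψ_f_self]
  refine ⟨c.g ∘ τ, c.W ∩ τ ⁻¹' c.V, h1.continuousOn.isOpen_inter_preimage c.isOpen_W c.isOpen_V,
    ⟨c.mem_W, ?_⟩, ?_, ?_, fun q hq => ?_⟩
  · rw [Set.mem_preimage, h2]
    exact c.φ_mem
  · rw [Function.comp_apply, h2, c.g_φ]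
  · exact c.contMDiffOn_g.comp (h1.mono Set.inter_subset_left) fun q hq => hq.2
  · rw [Function.comp_apply, c.f_g hq.2]
    have h3 : c.L (τ q) = c.ψ q := by simp [hτ, c.L_R]
    rw [h3, c.h_ψ _ hq.1]

/-- If the dimension drops, the fibres of a submersion are not singletons. -/
theorem exists_ne_of_lt (c : SubmersionChart m n f x) (hnm : n < m) : ∃ x', x' ≠ x ∧ f x' = f x := by
  obtain ⟨v, hv, hv0⟩ : ∃ v, c.L v = 0 ∧ v ≠ 0 := by
    have h1 : LinearMap.ker c.L.toLinearMap ≠ ⊥ :=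
      LinearMap.ker_ne_bot_of_finrank_lt (by simpa using hnm)
    obtain ⟨v, hv, hv0⟩ := Submodule.exists_mem_ne_zero_of_ne_bot h1
    exact ⟨v, by simpa using hv, hv0⟩
  have h1 : Filter.Tendsto (fun t : ℝ => c.φ x + t • v) (𝓝[≠] 0) (𝓝 (c.φ x)) := by
    have : Continuous fun t : ℝ => c.φ x + t • v := by fun_prop
    simpa using (this.tendsto 0).mono_left nhdsWithin_le_nhds
  obtain ⟨t, ht, ht0⟩ := ((h1.eventually (c.isOpen_V.mem_nhds c.φ_mem)).and
    self_mem_nhdsWithin).exists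
  refine ⟨c.g (c.φ x + t • v), fun h => ?_, ?_⟩
  · have h2 := c.φ_g _ ht
    rw [h] at h2
    have h3 : t • v = 0 := by simpa using h2
    exact (smul_ne_zero ht0 hv0) h3
  · rw [c.f_g ht]
    conv_rhs => rw [← c.g_φ, c.f_g c.φ_mem]
    simp [hv]

theorem mfderiv_comp_mfderiv_g (c : SubmersionChart m n f x)
    (hf : MDifferentiable (𝓡 m) (𝓡 n) f) {y : EuclideanSpace ℝ (Fin m)} (hy : y ∈ c.V) (v : EuclideanSpace ℝ (Fin m)) :
    mfderiv (𝓡 m) (𝓡 n) f (c.g y) (mfderiv 𝓘(ℝ, EuclideanSpace ℝ (Fin m)) (𝓡 m) c.g y v) =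
      mfderiv 𝓘(ℝ, EuclideanSpace ℝ (Fin n)) (𝓡 n) c.h (c.L y) (c.L v) := by
  have h1 : f ∘ c.g =ᶠ[𝓝 y] c.h ∘ c.L :=
    Filter.eventually_of_mem (c.isOpen_V.mem_nhds hy) fun z hz => c.f_g hz
  have h2 := h1.mfderiv_eq (I := 𝓘(ℝ, EuclideanSpace ℝ (Fin m))) (I' := 𝓡 n)
  rw [mfderiv_comp y (hf _) ((c.contMDiffOn_g.contMDiffAt
      (c.isOpen_V.mem_nhds hy)).mdifferentiableAt (by simp)),
    mfderiv_comp y ((c.contMDiffAt_h y hy).mdifferentiableAt (by simp))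
      c.L.differentiableAt.mdifferentiableAt, mfderiv_eq_fderiv, c.L.fderiv] at h2
  exact congrArg (fun A => A v) h2

end SubmersionChart

/-- The right inverse is the derivative of a local section through `x`. -/
theorem surjective_mfderiv_of_isSubmersion {f : M → N}
    (hf : Manifold.IsSubmersion (𝓡 m) (𝓡 n) ∞ f) (x : M) :
    ∃ R : TangentSpace (𝓡 n) (f x) →L[ℝ] TangentSpace (𝓡 m) x,
      ∀ v, mfderiv (𝓡 m) (𝓡 n) f x (R v) = v := by
  obtain ⟨c⟩ := nonempty_submersionChart hf x
  obtain ⟨σ, Q, hQ, hx, hσx, hσ, h⟩ := c.exists_localSection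
  have h1 : f ∘ σ =ᶠ[𝓝 (f x)] id := Filter.eventually_of_mem (hQ.mem_nhds hx) h
  have h2 := mfderiv_comp (f x) (I := 𝓡 n) (I' := 𝓡 m) (I'' := 𝓡 n) (g := f) (f := σ)
    (hf.contMDiff.mdifferentiable (by simp) _)
    ((hσ.contMDiffAt (hQ.mem_nhds hx)).mdifferentiableAt (by simp))
  rw [h1.mfderiv_eq, mfderiv_id, hσx] at h2
  exact ⟨mfderiv (𝓡 n) (𝓡 m) σ (f x), fun v => (congrArg (fun A => A v) h2).symm⟩

theorem finrank_ker_mfderiv_of_isSubmersion {f : M → N}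
    (hf : Manifold.IsSubmersion (𝓡 m) (𝓡 n) ∞ f) (x : M) :
    n + Module.finrank ℝ (LinearMap.ker (mfderiv (𝓡 m) (𝓡 n) f x).toLinearMap) = m := by
  obtain ⟨R, hR⟩ := surjective_mfderiv_of_isSubmersion hf x
  set A : EuclideanSpace ℝ (Fin m) →L[ℝ] EuclideanSpace ℝ (Fin n) := mfderiv (𝓡 m) (𝓡 n) f x
  have h1 : LinearMap.range A.toLinearMap = ⊤ :=
    LinearMap.range_eq_top.2 fun v => ⟨R v, hR v⟩
  have h2 := LinearMap.finrank_range_add_finrank_ker A.toLinearMap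
  rwa [h1, finrank_top, finrank_euclideanSpace_fin, finrank_euclideanSpace_fin] at h2

end Submersions

/-! ### Pullback of forms and its compatibility with `d` -/

section Pullback

variable {m n k : ℕ} {M N : Type u} [TopologicalSpace M]
  [ChartedSpace (EuclideanSpace ℝ (Fin m)) M] [TopologicalSpace N]
  [ChartedSpace (EuclideanSpace ℝ (Fin n)) N]

theorem pullback_apply (f : M → N) (β : DiffForm n N k) (x : M)
    (v : Fin k → TangentSpace (𝓡 m) x) :
    pullback f β x v = β (f x) fun i => mfderiv (𝓡 m) (𝓡 n) f x (v i) := rfl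

theorem rep_pullback {E : Type*} [NormedAddCommGroup E] [NormedSpace ℝ E] (f : M → N)
    (β : DiffForm n N k) {g : E → M} {y : E} (hf : MDifferentiableAt (𝓡 m) (𝓡 n) f (g y))
    (hg : MDifferentiableAt 𝓘(ℝ, E) (𝓡 m) g y) :
    rep (pullback (m := m) f β) g y = rep β.toFun (f ∘ g) y := by
  ext v
  rw [rep_apply, rep_apply, pullback_apply, mfderiv_comp y hf hg]
  rfl

variable [IsManifold (𝓡 m) ∞ M]

theorem chartRep_pullback {f : M → N} (hf : MDifferentiable (𝓡 m) (𝓡 n) f)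
    (β : DiffForm n N k) (x : M) {y : EuclideanSpace ℝ (Fin m)}
    (hy : y ∈ (extChartAt (𝓡 m) x).target) :
    chartRep (pullback f β) x y = rep β.toFun (f ∘ (extChartAt (𝓡 m) x).symm) y :=
  rep_pullback f β (hf _) (((contMDiffOn_extChartAt_symm (n := ∞) x).contMDiffAt
    ((isOpen_extChartAt_target x).mem_nhds hy)).mdifferentiableAt (by simp))

theorem contMDiffOn_comp_extChartAt_symm {f : M → N} (hf : ContMDiff (𝓡 m) (𝓡 n) ∞ f) (x : M) :
    ContMDiffOn 𝓘(ℝ, EuclideanSpace ℝ (Fin m)) (𝓡 n) ∞ (f ∘ (extChartAt (𝓡 m) x).symm)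
      (extChartAt (𝓡 m) x).target :=
  hf.comp_contMDiffOn (contMDiffOn_extChartAt_symm x)

variable [IsManifold (𝓡 n) ∞ N]

/-- The pullback of a differential form under a smooth map, as a differential form. -/
noncomputable def DiffForm.pullback {f : M → N} (hf : ContMDiff (𝓡 m) (𝓡 n) ∞ f)
    (β : DiffForm n N k) : DiffForm m M k where
  toFun := GeomQuant.pullback f β
  smooth x := (β.contDiffOn_rep (isOpen_extChartAt_target x)
    (contMDiffOn_comp_extChartAt_symm hf x)).congr fun _ hy =>
      chartRep_pullback (hf.mdifferentiable (by simp)) β x hy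

/-- In the chart `φ` around `x` the pullback is the expression of `β` along `f ∘ φ⁻¹`, so
`extDeriv_rep` applies; the chain rule then cancels `φ⁻¹` against `φ`. -/
theorem DiffForm.d_pullback_apply {f : M → N} (hf : ContMDiff (𝓡 m) (𝓡 n) ∞ f)
    (β : DiffForm n N k) (x : M) (v : Fin (k + 1) → TangentSpace (𝓡 m) x) :
    (β.pullback hf).d x v = β.d (f x) fun i => mfderiv (𝓡 m) (𝓡 n) f x (v i) := by
  set φ := extChartAt (𝓡 m) x with hφ
  have ho : φ.target ∈ 𝓝 (φ x) := (isOpen_extChartAt_target x).mem_nhds (mem_extChartAt_target x)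
  have h1 : chartRep (β.pullback hf).toFun x =ᶠ[𝓝 (φ x)] rep β.toFun (f ∘ φ.symm) :=
    Filter.eventually_of_mem ho fun y hy =>
      chartRep_pullback (hf.mdifferentiable (by simp)) β x hy
  have h2 : (β.pullback hf).d x v = extDeriv (rep β.toFun (f ∘ φ.symm)) (φ x) fun i =>
      mfderiv (𝓡 m) 𝓘(ℝ, EuclideanSpace ℝ (Fin m)) φ x (v i) := by
    rw [← h1.extDeriv_eq]
    rfl
  rw [h2, β.extDeriv_rep (isOpen_extChartAt_target x) (contMDiffOn_comp_extChartAt_symm hf x)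
    (mem_extChartAt_target x)]
  have h3 : (f ∘ φ.symm) ∘ φ =ᶠ[𝓝 x] f := by
    filter_upwards [extChartAt_source_mem_nhds (I := 𝓡 m) x] with z hz
    simp [φ.left_inv hz]
  have h4 := mfderiv_comp x (I := 𝓡 m) (I' := 𝓘(ℝ, EuclideanSpace ℝ (Fin m))) (I'' := 𝓡 n)
    (g := f ∘ φ.symm) (f := φ)
    (((contMDiffOn_comp_extChartAt_symm hf x).contMDiffAt ho).mdifferentiableAt (by simp))
    (mdifferentiableAt_extChartAt (mem_chart_source _ _))
  rw [h3.mfderiv_eq] at h4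
  rw [h4]
  have h5 : (f ∘ φ.symm) (φ x) = f x := h3.eq_of_nhds
  change β.d ((f ∘ φ.symm) (φ x)) _ = _
  rw [h5]
  rfl

end Pullback

/-! ### Descent of forms along a submersion -/

section Descent

variable {m n k : ℕ} {M N : Type u} [TopologicalSpace M]
  [ChartedSpace (EuclideanSpace ℝ (Fin m)) M] [TopologicalSpace N]
  [ChartedSpace (EuclideanSpace ℝ (Fin n)) N] [IsManifold (𝓡 m) ∞ M]

/-- If `α` is fibrewise the pullback of `B` under a submersion `f` and the exterior derivative of
`α` is killed by the vectors tangent to the fibres of `f`, then `B` is locally constant along the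
fibres. -/
theorem eventually_eq_of_contract {f : M → N} (hf : Manifold.IsSubmersion (𝓡 m) (𝓡 n) ∞ f)
    (α : DiffForm m M k) (B : M → EuclideanSpace ℝ (Fin n) [⋀^Fin k]→L[ℝ] ℝ)
    (hB : ∀ (x : M) (v : Fin k → TangentSpace (𝓡 m) x),
      α x v = B x fun i => mfderiv (𝓡 m) (𝓡 n) f x (v i))
    (hd : ∀ (x : M) (v : TangentSpace (𝓡 m) x), mfderiv (𝓡 m) (𝓡 n) f x v = 0 →
      contract v (α.d x) = 0) (x : M) :
    ∀ᶠ x' in 𝓝 x, f x' = f x → B x' = B x := by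
  obtain ⟨c⟩ := nonempty_submersionChart hf x
  have hfd : MDifferentiable (𝓡 m) (𝓡 n) f := hf.contMDiff.mdifferentiable (by simp)
  have hη : ∀ y ∈ c.V, ∀ v : Fin k → EuclideanSpace ℝ (Fin m), rep α.toFun c.g y v = B (c.g y)
      fun i => mfderiv 𝓘(ℝ, EuclideanSpace ℝ (Fin n)) (𝓡 n) c.h (c.L y) (c.L (v i)) := by
    intro y hy v
    rw [rep_apply, hB]
    congr 1
    funext i
    exact c.mfderiv_comp_mfderiv_g hfd hy (v i)
  have hsm : ContDiffOn ℝ ∞ (rep α.toFun c.g) c.V := α.contDiffOn_rep c.isOpen_V c.contMDiffOn_g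
  have hdiff : ∀ y ∈ c.V, DifferentiableAt ℝ (rep α.toFun c.g) y := fun y hy =>
    (hsm.contDiffAt (c.isOpen_V.mem_nhds hy)).differentiableAt (by simp)
  have hder : ∀ y ∈ c.V, ∀ w, c.L w = 0 → fderiv ℝ (rep α.toFun c.g) y w = 0 := by
    intro y hy w hw
    refine fderiv_apply_eq_zero_of_contract (hdiff y hy) ?_ fun v => ?_
    · filter_upwards [c.isOpen_V.mem_nhds hy] with z hz v ⟨i, hi⟩
      rw [hη z hz]
      refine (B (c.g z)).map_coord_zero i ?_
      rw [hi, hw]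
      exact map_zero (mfderiv 𝓘(ℝ, EuclideanSpace ℝ (Fin n)) (𝓡 n) c.h (c.L z))
    · rw [α.extDeriv_rep c.isOpen_V c.contMDiffOn_g hy]
      have h1 := hd (c.g y) (mfderiv 𝓘(ℝ, EuclideanSpace ℝ (Fin m)) (𝓡 m) c.g y w)
        (by rw [c.mfderiv_comp_mfderiv_g hfd hy, hw]
            exact map_zero (mfderiv 𝓘(ℝ, EuclideanSpace ℝ (Fin n)) (𝓡 n) c.h (c.L y)))
      have h2 := congrArg (fun η => η fun i =>
        mfderiv 𝓘(ℝ, EuclideanSpace ℝ (Fin m)) (𝓡 m) c.g y (v i)) h1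
      rw [contract_apply] at h2
      refine Eq.trans ?_ h2
      refine congrArg (α.d (c.g y)) (funext fun i => ?_)
      refine Fin.cases rfl (fun j => rfl) i
  -- A ball is convex, so the segment from `φ x` to `φ x'` stays in the chart; when `f x' = f x` its
  -- direction lies in `ker L`.
  obtain ⟨ε, hε, hball⟩ := Metric.isOpen_iff.1 c.isOpen_V _ c.φ_mem
  filter_upwards [c.eventually_g_φ, c.continuousAt_φ.eventually (Metric.ball_mem_nhds _ hε)]
    with x' hgx hx' hff
  have hL : c.L (c.φ x') = c.L (c.φ x) := by
    rw [← c.ψ_f _ (hball hx'), ← c.ψ_f _ c.φ_mem, hgx, c.g_φ, hff]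
  have hconst : rep α.toFun c.g (c.φ x') = rep α.toFun c.g (c.φ x) := by
    set w := c.φ x' - c.φ x with hw
    have hseg : ∀ t ∈ Set.Icc (0 : ℝ) 1, c.φ x + t • w ∈ c.V := fun t ht =>
      hball ((convex_ball (c.φ x) ε).add_smul_sub_mem (Metric.mem_ball_self hε) hx' ht)
    have hd1 : ∀ t ∈ Set.Icc (0 : ℝ) 1,
        HasDerivAt (fun t : ℝ => rep α.toFun c.g (c.φ x + t • w)) 0 t := by
      intro t ht
      have h1 : HasDerivAt (fun t : ℝ => c.φ x + t • w) w t := by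
        simpa using ((hasDerivAt_id t).smul_const w).const_add (c.φ x)
      have h2 := (hdiff _ (hseg t ht)).hasFDerivAt.comp_hasDerivAt t h1
      rwa [hder _ (hseg t ht) w (by rw [hw, map_sub, hL, sub_self])] at h2
    have h1 := constant_of_has_deriv_right_zero
      (fun t ht => (hd1 t ht).continuousAt.continuousWithinAt)
      (fun t ht => (hd1 t ⟨ht.1, ht.2.le⟩).hasDerivWithinAt) 1 (by simp)
    simpa [hw] using h1
  ext v
  -- Each `v i` has the form `D (L (R (u i)))`, and `D` is the same at both points because `L (φ x')
  -- = L (φ x)`. Equality of local expressions thus becomes equality of `B x'` and `B x`.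
  let D : EuclideanSpace ℝ (Fin n) →L[ℝ] EuclideanSpace ℝ (Fin n) :=
    mfderiv 𝓘(ℝ, EuclideanSpace ℝ (Fin n)) (𝓡 n) c.h (c.L (c.φ x))
  have hDs : Function.Surjective D := c.surjective_mfderiv_h
  choose u hu using fun i => hDs (v i)
  have h1 := hη _ (hball hx') fun i => c.R (u i)
  have h2 := hη _ c.φ_mem fun i => c.R (u i)
  rw [hL, hgx, hconst, h2, c.g_φ] at h1
  have h3 : (fun i => D (c.L (c.R (u i)))) = v := funext fun i => by rw [c.L_R, hu]
  rw [← h3]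
  exact h1.symm

/-- A form on the total space of a surjective submersion that is fibrewise the pullback of a field
of forms on the base is the pullback of a smooth form. -/
theorem exists_eq_pullback [IsManifold (𝓡 n) ∞ N] {f : M → N}
    (hf : Manifold.IsSubmersion (𝓡 m) (𝓡 n) ∞ f)
    (hs : Function.Surjective f) (α : DiffForm m M k)
    (b : ∀ q : N, TangentSpace (𝓡 n) q [⋀^Fin k]→L[ℝ] ℝ)
    (hb : ∀ (x : M) (v : Fin k → TangentSpace (𝓡 m) x),
      α x v = b (f x) fun i => mfderiv (𝓡 m) (𝓡 n) f x (v i)) :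
    ∃ β : DiffForm n N k, ∀ x, α x = pullback f β x := by
  refine ⟨⟨b, fun q₀ y hy => ?_⟩, fun x => ?_⟩
  · obtain ⟨x, hx⟩ := hs ((extChartAt (𝓡 n) q₀).symm y)
    obtain ⟨c⟩ := nonempty_submersionChart hf x
    obtain ⟨σ, Q, hQ, hxQ, -, hσ, hfσ⟩ := c.exists_localSection
    set φ := extChartAt (𝓡 n) q₀ with hφ
    have hψ : ContMDiffOn 𝓘(ℝ, EuclideanSpace ℝ (Fin n)) (𝓡 n) ∞ φ.symm φ.target :=
      contMDiffOn_extChartAt_symm q₀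
    have hV : IsOpen (φ.target ∩ φ.symm ⁻¹' Q) :=
      hψ.continuousOn.isOpen_inter_preimage (isOpen_extChartAt_target q₀) hQ
    have hyV : y ∈ φ.target ∩ φ.symm ⁻¹' Q := ⟨hy, by rwa [Set.mem_preimage, ← hx]⟩
    have hg : ContMDiffOn 𝓘(ℝ, EuclideanSpace ℝ (Fin n)) (𝓡 m) ∞ (σ ∘ φ.symm)
        (φ.target ∩ φ.symm ⁻¹' Q) :=
      hσ.comp (hψ.mono Set.inter_subset_left) fun z hz => hz.2
    have h1 : ∀ z ∈ φ.target ∩ φ.symm ⁻¹' Q,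
        chartRep b q₀ z = rep α.toFun (σ ∘ φ.symm) z := by
      intro z hz
      -- Since `f ∘ σ = id`, the pullback of `α` under `σ` is `b`; its smoothness is inherited from
      -- `α`.
      have h2 : f ∘ (σ ∘ φ.symm) =ᶠ[𝓝 z] φ.symm :=
        Filter.eventually_of_mem (hV.mem_nhds hz) fun w hw => hfσ _ hw.2
      rw [chartRep_eq_rep, ← rep_congr b h2]
      ext v
      rw [rep_apply, rep_apply, hb, mfderiv_comp z (hf.contMDiff.mdifferentiable (by simp) _)
        ((hg.contMDiffAt (hV.mem_nhds hz)).mdifferentiableAt (by simp))]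
      rfl
    have h2 := ((α.contDiffOn_rep hV hg).contDiffAt (hV.mem_nhds hyV)).congr_of_eventuallyEq
      (Filter.eventually_of_mem (hV.mem_nhds hyV) h1)
    exact h2.contDiffWithinAt
  · ext v
    exact hb x v

end Descent

/-! ### Fibres of the canonical bundle -/

section CanonicalBundle

variable {m n : ℕ} {M : Type u} [TopologicalSpace M] [ChartedSpace (EuclideanSpace ℝ (Fin m)) M]

/-- On a generator, an argument in `P` produces a zero column of the determinant. -/
theorem apply_eq_zero_of_mem_canonicalFiber {P : ∀ x : M, Submodule ℝ (TangentSpace (𝓡 m) x)}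
    {x : M} {η : TangentSpace (𝓡 m) x [⋀^Fin n]→L[ℝ] ℝ} (hη : η ∈ canonicalFiber n P x)
    {v : Fin n → TangentSpace (𝓡 m) x} {i : Fin n} (hi : v i ∈ P x) : η v = 0 := by
  induction hη using Submodule.span_induction with
  | mem η h =>
    obtain ⟨θ, hθ, rfl⟩ := h
    rw [wedge_apply]
    exact Matrix.det_eq_zero_of_column_eq_zero i fun j => hθ j _ hi
  | zero => rfl
  | add η ξ _ _ h h' =>
    change η v + ξ v = 0
    rw [h, h', add_zero]
  | smul a η _ h =>
    change a • η v = 0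
    rw [h, smul_zero]

/-- The degree of `β` equals the dimension of `N`, so `β` at `f x` is a multiple of the determinant
of the coordinates. The coordinates composed with `df` annihilate `P`, and their wedge generates the
pullback. -/
theorem pullback_mem_canonicalFiber {N : Type u} [TopologicalSpace N]
    [ChartedSpace (EuclideanSpace ℝ (Fin n)) N] {P : ∀ x : M, Submodule ℝ (TangentSpace (𝓡 m) x)}
    {f : M → N} {x : M} (hP : ∀ v ∈ P x, mfderiv (𝓡 m) (𝓡 n) f x v = 0) (β : DiffForm n N n) :
    pullback f β x ∈ canonicalFiber n P x := by
  set e := EuclideanSpace.basisFun (Fin n) ℝ with he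
  set b : EuclideanSpace ℝ (Fin n) [⋀^Fin n]→L[ℝ] ℝ := β (f x) with hb
  set A : EuclideanSpace ℝ (Fin m) →L[ℝ] EuclideanSpace ℝ (Fin n) :=
    mfderiv (𝓡 m) (𝓡 n) f x with hA
  let θ : Fin n → (TangentSpace (𝓡 m) x →L[ℝ] ℝ) := fun i => (EuclideanSpace.proj i).comp A
  have h1 : pullback f β x = b e • wedge (m := m) (x := x) θ := by
    ext v
    have h2 := congrArg (fun g => g fun i => A (v i))
      (AlternatingMap.eq_smul_basis_det e.toBasis b.toAlternatingMap)
    have h3 : (e.toBasis.det fun i => A (v i)) =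
        Matrix.det (Matrix.of fun i j => θ i (v j)) := by
      rw [Module.Basis.det_apply]
      rfl
    change b (fun i => A (v i)) = b e * wedge (m := m) (x := x) θ v
    rw [wedge_apply, ← h3]
    have h4 : (e.toBasis : Fin n → EuclideanSpace ℝ (Fin n)) = e := by simp
    simpa [h4] using h2
  rw [h1]
  refine Submodule.smul_mem _ _ (Submodule.subset_span ⟨θ, fun i v hv => ?_, rfl⟩)
  have h2 : A v = 0 := hP v hv
  change EuclideanSpace.proj (𝕜 := ℝ) i (A v) = 0
  rw [h2, map_zero]

end CanonicalBundle

/-! ### Global sections of a distribution -/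

section Sections

variable {m k : ℕ} {M : Type u} [TopologicalSpace M] [ChartedSpace (EuclideanSpace ℝ (Fin m)) M]
  [T2Space M] [IsManifold (𝓡 m) ∞ M]

/-- Every vector of a distribution extends to a global section. -/
theorem exists_isSection_eq {D : ∀ x : M, Submodule ℝ (TangentSpace (𝓡 m) x)}
    (hD : IsDistribution k D) {x : M} {v : TangentSpace (𝓡 m) x} (hv : v ∈ D x) :
    ∃ X : ∀ x : M, TangentSpace (𝓡 m) x, IsSection D X ∧ X x = v := by
  obtain ⟨U, hU, hxU, Y, hY, hspan⟩ := hD.2 x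
  rw [hspan x hxU] at hv
  obtain ⟨a, ha⟩ := (Submodule.mem_span_range_iff_exists_fun ℝ).1 hv
  -- The coefficients `a` of `v` in the local frame are kept constant, and a bump function with
  -- closed support in `U` extends the combination by zero.
  obtain ⟨ρ, -, hρ⟩ := (SmoothBumpFunction.nhds_basis_tsupport (I := 𝓡 m) x).mem_iff.1
    (hU.mem_nhds hxU)
  set Z : ∀ y : M, TangentSpace (𝓡 m) y := fun y => ∑ i, a i • Y i y with hZ
  have hZs : IsSmoothVectorFieldOn Z U := by
    refine ContMDiffOn.sum_section (V := TangentSpace (𝓡 m)) fun i _ => ?_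
    exact contMDiffOn_const.smul_section (hY i)
  refine ⟨fun y => ρ y • Z y, ⟨?_, fun y => ?_⟩, ?_⟩
  · have h1 := ContMDiffOn.smul_section_of_tsupport (V := TangentSpace (𝓡 m)) (s := Z)
      ρ.contMDiff.contMDiffOn hU hρ hZs
    exact h1.contMDiffOn
  · by_cases hy : y ∈ U
    · refine Submodule.smul_mem _ _ (Submodule.sum_mem _ fun i _ => Submodule.smul_mem _ _ ?_)
      rw [hspan y hy]
      exact Submodule.subset_span ⟨i, rfl⟩
    · have h1 : ρ y = 0 := image_eq_zero_of_notMem_tsupport fun h => hy (hρ h)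
      change ρ y • Z y ∈ D y
      rw [h1, zero_smul]
      exact Submodule.zero_mem _
  · change ρ x • Z x = v
    rw [ρ.eq_one, one_smul]
    exact ha

end Sections

/-! ### Leaves and the derivative of the leaf projection -/

section Leaves

variable {m k : ℕ} {M : Type u} [TopologicalSpace M] [ChartedSpace (EuclideanSpace ℝ (Fin m)) M]
  {D : ∀ x : M, Submodule ℝ (TangentSpace (𝓡 m) x)}

theorem OnCommonIntegralSubmanifold.refl_left {x y : M} (h : OnCommonIntegralSubmanifold k D x y) :
    OnCommonIntegralSubmanifold k D x x := by
  obtain ⟨S, t, c, i, hi, hx, -⟩ := h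
  exact ⟨S, t, c, i, hi, hx, hx⟩

theorem OnCommonIntegralSubmanifold.symm {x y : M} (h : OnCommonIntegralSubmanifold k D x y) :
    OnCommonIntegralSubmanifold k D y x := by
  obtain ⟨S, t, c, i, hi, hx, hy⟩ := h
  exact ⟨S, t, c, i, hi, hy, hx⟩

theorem leafProj_eq_of_isIntegralSubmanifold {S : Type u} [TopologicalSpace S]
    [ChartedSpace (EuclideanSpace ℝ (Fin k)) S] {i : S → M} (hi : IsIntegralSubmanifold k D S i)
    (s t : S) : leafProj k D (i s) = leafProj k D (i t) :=
  Quotient.sound (Relation.EqvGen.rel _ _ ⟨S, _, _, i, hi, ⟨s, rfl⟩, ⟨t, rfl⟩⟩)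

theorem surjective_leafProj : Function.Surjective (leafProj k D) := Quotient.mk_surjective

/-- A point whose leaf is not a singleton lies on an integral submanifold. -/
theorem onCommonIntegralSubmanifold_of_leafProj_eq {x y : M} (h : leafProj k D x = leafProj k D y)
    (hne : x ≠ y) : OnCommonIntegralSubmanifold k D x x := by
  have h1 : Relation.EqvGen (OnCommonIntegralSubmanifold k D) x y := Quotient.exact h
  -- Both endpoints are recorded so that the induction passes through symmetry and transitivity;
  -- only reflexivity yields the first alternative.
  have h2 : x = y ∨ (OnCommonIntegralSubmanifold k D x x ∧ OnCommonIntegralSubmanifold k D y y) := by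
    clear hne h
    induction h1 with
    | rel x y h => exact Or.inr ⟨h.refl_left, h.symm.refl_left⟩
    | refl x => exact Or.inl rfl
    | symm x y _ ih => exact ih.imp Eq.symm And.symm
    | trans x y z _ _ ih ih' =>
      rcases ih with rfl | ih
      · exact ih'
      · rcases ih' with rfl | ih'
        · exact Or.inr ih
        · exact Or.inr ⟨ih.1, ih'.2⟩
  exact (h2.resolve_left hne).1

/-- A function that is locally constant along the leaves is constant on each leaf. -/
theorem eq_of_leafProj_eq {A : Type*} {B : M → A}
    (hB : ∀ x, ∀ᶠ x' in 𝓝 x, leafProj k D x' = leafProj k D x → B x' = B x) {x y : M}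
    (h : leafProj k D x = leafProj k D y) : B x = B y := by
  have h1 : Relation.EqvGen (OnCommonIntegralSubmanifold k D) x y := Quotient.exact h
  clear h
  induction h1 with
  | rel x y h =>
    obtain ⟨S, _, _, i, hi, ⟨s, rfl⟩, ⟨t, rfl⟩⟩ := h
    have := hi.connected
    -- The integral submanifold lies in one leaf, so along `i` the condition in `hB` always holds;
    -- connectedness of `S` finishes.
    have h2 : IsLocallyConstant (B ∘ i) := by
      rw [IsLocallyConstant.iff_eventually_eq]
      intro s
      filter_upwards [hi.smooth.continuous.continuousAt.eventually (hB (i s))] with t ht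
      exact ht (leafProj_eq_of_isIntegralSubmanifold hi t s)
    exact h2.apply_eq_of_preconnectedSpace s t
  | refl x => rfl
  | symm x y _ ih => exact ih.symm
  | trans x y z _ _ ih ih' => exact ih.trans ih'

variable {n : ℕ} [ChartedSpace (EuclideanSpace ℝ (Fin n)) (LeafSpace k D)]

theorem mfderiv_leafProj_eq_zero_of_onCommonIntegralSubmanifold
    (hf : MDifferentiable (𝓡 m) (𝓡 n) (leafProj k D)) {x : M}
    (hx : OnCommonIntegralSubmanifold k D x x) {v : TangentSpace (𝓡 m) x} (hv : v ∈ D x) :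
    mfderiv (𝓡 m) (𝓡 n) (leafProj k D) x v = 0 := by
  obtain ⟨S, _, _, i, hi, ⟨s, rfl⟩, -⟩ := hx
  rw [← hi.range_mfderiv] at hv
  obtain ⟨w, rfl⟩ := hv
  have h1 : leafProj k D ∘ i = fun _ => leafProj k D (i s) :=
    funext fun t => leafProj_eq_of_isIntegralSubmanifold hi t s
  have h2 := mfderiv_comp s (I := 𝓡 k) (I' := 𝓡 m) (I'' := 𝓡 n) (g := leafProj k D) (f := i)
    (hf _) (hi.smooth.mdifferentiable (by simp) s)
  rw [h1, mfderiv_const] at h2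
  exact (congrArg (fun A => A w) h2).symm

/-- If the projection to the leaf space of a rank-`k` distribution on an `m`-manifold is a
submersion onto an `(m - k)`-manifold, its derivative vanishes on the distribution. Integrability
of the distribution is automatic: the leaves are not singletons unless `k = 0`. -/
theorem mfderiv_leafProj_eq_zero (hf : Manifold.IsSubmersion (𝓡 m) (𝓡 n) ∞ (leafProj k D))
    (hk : ∀ x, Module.finrank ℝ (D x) = k) (hkm : n + k = m) {x : M}
    {v : TangentSpace (𝓡 m) x} (hv : v ∈ D x) :
    mfderiv (𝓡 m) (𝓡 n) (leafProj k D) x v = 0 := by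
  rcases Nat.eq_zero_or_pos k with rfl | hpos
  · have h1 : D x = ⊥ := by
      have : Module.Finite ℝ (TangentSpace (𝓡 m) x) :=
        inferInstanceAs (Module.Finite ℝ (EuclideanSpace ℝ (Fin m)))
      exact Submodule.finrank_eq_zero.1 (hk x)
    rw [h1, Submodule.mem_bot] at hv
    rw [hv, map_zero]
  · obtain ⟨c⟩ := nonempty_submersionChart hf x
    obtain ⟨y, hne, hy⟩ := c.exists_ne_of_lt (by omega)
    exact mfderiv_leafProj_eq_zero_of_onCommonIntegralSubmanifold
      (hf.contMDiff.mdifferentiable (by simp))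
      (onCommonIntegralSubmanifold_of_leafProj_eq hy.symm hne.symm) hv

/-- The distribution lies in the kernel, and both have dimension `k = m - n`. -/
theorem ker_mfderiv_leafProj (hf : Manifold.IsSubmersion (𝓡 m) (𝓡 n) ∞ (leafProj k D))
    (hk : ∀ x, Module.finrank ℝ (D x) = k) (hkm : n + k = m) (x : M) :
    LinearMap.ker (mfderiv (𝓡 m) (𝓡 n) (leafProj k D) x).toLinearMap = D x := by
  have : Module.Finite ℝ (TangentSpace (𝓡 m) x) :=
    inferInstanceAs (Module.Finite ℝ (EuclideanSpace ℝ (Fin m)))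
  refine (Submodule.eq_of_le_of_finrank_eq
    (fun v hv => mfderiv_leafProj_eq_zero hf hk hkm hv) ?_).symm
  have := finrank_ker_mfderiv_of_isSubmersion hf x
  rw [hk]
  omega

end Leaves

end GeomQuant

/-! ### The main theorem -/

open GeomQuant
theorem mainTheorem7 {n : ℕ} {M : Type*} [TopologicalSpace M] [T2Space M]
    [SecondCountableTopology M] [ChartedSpace (EuclideanSpace ℝ (Fin (2 * n))) M]
    [IsManifold (𝓡 (2 * n)) ∞ M]
    (Ω : DiffForm (2 * n) M 2) (hΩ : IsSymplectic Ω)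
    (P : ∀ x : M, Submodule ℝ (TangentSpace (𝓡 (2 * n)) x)) (hP : IsRealPolarization Ω P)
    [T2Space (LeafSpace n P)] [SecondCountableTopology (LeafSpace n P)]
    [ChartedSpace (EuclideanSpace ℝ (Fin n)) (LeafSpace n P)]
    [IsManifold (𝓡 n) ∞ (LeafSpace n P)]
    (hπ : Manifold.IsSubmersion (𝓡 (2 * n)) (𝓡 n) ∞ (leafProj n P)) :
    (∀ β : DiffForm n (LeafSpace n P) n, ∃ α : DiffForm (2 * n) M n,
      (∀ x, α x = pullback (leafProj n P) β x) ∧ IsPolarizedSection P α) ∧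
    (∀ α : DiffForm (2 * n) M n, IsPolarizedSection P α →
      ∃ β : DiffForm n (LeafSpace n P) n, ∀ x, α x = pullback (leafProj n P) β x) := by
  have hker := ker_mfderiv_leafProj hπ hP.distribution.1 (two_mul n).symm
  have hker' : ∀ x v, v ∈ P x ↔ mfderiv (𝓡 (2 * n)) (𝓡 n) (leafProj n P) x v = 0 := by
    intro x v
    rw [← hker x]
    rfl
  refine ⟨fun β => ⟨β.pullback hπ.contMDiff, fun x => rfl, fun x => ?_, fun X hX x => ?_⟩,
    fun α hα => ?_⟩
  · exact pullback_mem_canonicalFiber (fun v hv => (hker' x v).1 hv) β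
  · ext w
    rw [contract_apply, β.d_pullback_apply hπ.contMDiff]
    exact ContinuousAlternatingMap.map_coord_zero _ (0 : Fin (n + 1)) ((hker' x _).1 (hX.2 x))
  · have h1 : ∀ x, ∃ b : EuclideanSpace ℝ (Fin n) [⋀^Fin n]→L[ℝ] ℝ,
        α x = b.compContinuousLinearMap (mfderiv (𝓡 (2 * n)) (𝓡 n) (leafProj n P) x) := by
      intro x
      obtain ⟨R, hR⟩ := surjective_mfderiv_of_isSubmersion hπ x
      refine exists_eq_compContinuousLinearMap (E := EuclideanSpace ℝ (Fin (2 * n)))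
        (F := EuclideanSpace ℝ (Fin n)) hR (α x) ?_
      rintro v ⟨i, hi⟩
      exact apply_eq_zero_of_mem_canonicalFiber (hα.1 x) ((hker' x (v i)).2 hi)
    choose B hB using h1
    have hB' : ∀ (x : M) (v : Fin n → TangentSpace (𝓡 (2 * n)) x),
        α x v = B x fun i => mfderiv (𝓡 (2 * n)) (𝓡 n) (leafProj n P) x (v i) := fun x v =>
      congrArg (fun η => η v) (hB x)
    -- Polarization is tested on global sections of `P`, whereas descent needs single vertical
    -- vectors; each of these extends to a global section.
    have hloc := eventually_eq_of_contract hπ α B hB' fun x v hv => by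
      obtain ⟨X, hX, rfl⟩ := exists_isSection_eq hP.distribution ((hker' x v).2 hv)
      exact hα.2 X hX x
    -- The form at a leaf is read off at an arbitrary point of it; constancy of `B` on leaves makes
    -- the choice immaterial.
    refine exists_eq_pullback hπ surjective_leafProj α
      (fun q => B (Function.surjInv surjective_leafProj q)) fun x v => (hB' x v).trans ?_
    have h2 : B x = B (Function.surjInv surjective_leafProj (leafProj n P x)) :=
      eq_of_leafProj_eq hloc (Function.surjInv_eq surjective_leafProj (leafProj n P x)).symm
    exact congrArg (fun b => b fun i => mfderiv (𝓡 (2 * n)) (𝓡 n) (leafProj n P) x (v i)) h2
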